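/- **Lemma.** Let $G=(V,E)$ be a finite, connected, simple undirected graph, each of whose nodes is labelled public or private, and let $d_i$ be the degree of $v_i$ in $G$. A public-cluster is a connected component of the subgraph induced by the public nodes. Let $C^*=(V^*,E^*)$ be a largest public-cluster (one with the most nodes), and assume that it has at least two nodes. For $v_i\in V^*$ let $d_i^*=|\{v_j\in V^* : (v_i,v_j)\in E^*\}|$, and let $D^*=\sum_{v_i\in V^*}d_i^*$. Consider the following random walk. The first sample $v_{x_1}$ is a (possibly random) node of $V^*$. Given the $k$-th sample $v_{x_k}$, select a neighbor of $v_{x_k}$ in $G$ uniformly at random; if it is public, it is the next sample $v_{x_{k+1}}$, and otherwise select again a neighbor of $v_{x_k}$, uniformly at random and independently of the earlier selections, until a public one is found. Then, almost surely, every sample is found after finitely many selections, and $$\hat d_{avg}=\frac{r}{\sum_{k=1}^r \frac{1}{d_{x_k}}}\ \longrightarrow\ \tilde d_{avg}=\frac{D^*}{\sum_{v_i\in V^*}\frac{d_i^*}{d_i}}\qquad (r\to\infty).$$ -/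

import Mathlib

open MeasureTheory Filter Topology

namespace PublicWalk

variable {V : Type*}

/-- A public-cluster of a graph `G` whose set of public nodes is `pub`: a maximal connected
subgraph of `G` all of whose nodes are public (that is, a connected component of the graph
that `G` induces on the public nodes, with all its edges). -/
def IsPublicCluster (G : SimpleGraph V) (pub : Set V) (C : G.Subgraph) : Prop :=
  Maximal (fun C' : G.Subgraph => C'.Connected ∧ C'.verts ⊆ pub) C

/-- A largest public-cluster: one with the largest number of nodes. -/
def IsLargestPublicCluster (G : SimpleGraph V) (pub : Set V) (C : G.Subgraph) : Prop :=
  IsPublicCluster G pub C ∧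
    ∀ C' : G.Subgraph, IsPublicCluster G pub C' → C'.verts.ncard ≤ C.verts.ncard

/-- The public-degree `d*` of a node: its number of neighbours in the cluster `C`. -/
noncomputable def publicDegree {G : SimpleGraph V} (C : G.Subgraph) (v : V) : ℕ :=
  {w | w ∈ C.verts ∧ C.Adj v w}.ncard

open scoped Classical in
/-- The sum of the public-degrees over the nodes of the cluster, `D*`. -/
noncomputable def publicDegreeSum [Fintype V] {G : SimpleGraph V} (C : G.Subgraph) : ℕ :=
  ∑ v : V with v ∈ C.verts, publicDegree C v

open scoped Classical in
/-- The value `D* / ∑ d* / d`, the sum being over the nodes of the cluster. -/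
noncomputable def limitAvgDegree [Fintype V] (G : SimpleGraph V) [DecidableRel G.Adj]
    (C : G.Subgraph) : ℝ :=
  (publicDegreeSum C : ℝ) / ∑ v : V with v ∈ C.verts, (publicDegree C v : ℝ) / (G.degree v : ℝ)

open scoped Classical in
/-- The node at which the walk stands just before its `t`-th neighbour selection (counted from
`0`), when it starts at `seed` and the successive selections are `u 0, u 1, …`: it moves to the
selected node if that is public, and otherwise stays and selects again. -/
noncomputable def position (pub : Set V) (seed : V) (u : ℕ → V) : ℕ → V
  | 0 => seed
  | t + 1 => if u t ∈ pub then u t else position pub seed u t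

/-- The nodes sampled by the walk: `sample 0` is the seed (the first sample), and the next
samples are the successive public nodes among the selections. -/
noncomputable def sample (pub : Set V) (seed : V) (u : ℕ → V) : ℕ → V
  | 0 => seed
  | k + 1 => u (Nat.nth (fun t => u t ∈ pub) k)

/-- The estimator `r / ∑ 1 / d` of the average degree, from the first `r` samples. -/
noncomputable def avgDegreeEstimate [Fintype V] (G : SimpleGraph V) [DecidableRel G.Adj]
    (x : ℕ → V) (r : ℕ) : ℝ :=
  (r : ℝ) / ∑ k ∈ Finset.range r, 1 / (G.degree (x k) : ℝ)

/-- The random variables `seed` and `u 0, u 1, …` are the seed and the successive neighbour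
selections of the random walk: the seed lies in the cluster `C`, and given the seed and all
previous selections, the next selection is uniformly distributed over all the neighbours in `G`,
public or private, of the node where the walk stands. -/
structure IsWalk [Fintype V] [MeasurableSpace V] (G : SimpleGraph V) [DecidableRel G.Adj]
    (pub : Set V) (C : G.Subgraph) {Ω : Type*} [MeasurableSpace Ω] (μ : Measure Ω)
    (seed : Ω → V) (u : ℕ → Ω → V) : Prop where
  measurable_seed : Measurable seed
  measurable_selection : ∀ t, Measurable (u t)
  seed_mem : ∀ᵐ ω ∂μ, seed ω ∈ C.verts
  selection_law : ∀ (t : ℕ) (v : V) (h : ℕ → V) (y : V),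
    μ {ω | (seed ω = v ∧ ∀ i < t, u i ω = h i) ∧ u t ω = y} =
      μ {ω | seed ω = v ∧ ∀ i < t, u i ω = h i} *
        (if G.Adj (position pub v h t) y then (G.degree (position pub v h t) : ENNReal)⁻¹ else 0)

end PublicWalk

/-!
The nodes at which the walk stands form a Markov chain on the cluster. A law of large numbers for
this chain follows from a martingale argument rather than from general ergodic theory.

Let `Y t` be the node of the walk before its `t`-th selection `u t`. If `φ v` has sum zero over the
`G`-neighbours of `v`, for every `v`, then `φ (Y t) (u t)` is a bounded martingale difference. By
orthogonality (`IsWalk.integral_past_mul_step_eq_zero`) the second moment of its `t`-th partial sum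
is at most `K ^ 2 * t`, so that the averages tend to zero almost surely along the squares, and then
along all `t`, since the summands are bounded (`IsWalk.ae_tendsto_selectionSum_div`).

This is applied to two functions `φ`, both set to zero off the cluster, which the walk never leaves.

* `publicStep`, the indicator of a public selection minus its conditional probability `d* / d`. This
  probability is bounded below on the cluster, so the public selections have positive lower density.
* `poissonStep`, which is `1 / d y - c + (g y - g v)` if the selected node `y` is public, and `0`
  otherwise. Here `c` is the mean of `1 / d` over the cluster with weights `d*`, and `g` is chosen
  such that the sum over the neighbours vanishes. This condition is a Poisson equation for the
  Laplacian of the cluster, and it is solvable because the cluster is connected and the right-hand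
  side has sum zero (`exists_laplacian_eq`, `exists_poisson_solution`).

Along a path the `g`-terms telescope (`selectionSum_poissonStep`), so the sum of `1 / d - c` over
the first `r` public selections is `o(t)` at the time `t` of the `r`-th one, and this time is `O(r)`
(`tendsto_average_of_tendsto_selectionSum`). Thus the averages of `1 / d` over the samples tend to
`c`, and the limit of the estimator is `c⁻¹ = D* / ∑ d* / d`.
-/

/-! ### The graph Laplacian and the cluster -/

namespace PublicWalk

open scoped Classical in
/-- On a finite connected graph, every function with sum zero is in the range of the Laplacian:
adding the sum of `g` to the Laplacian of `g` makes it injective, hence surjective, and the added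
term vanishes when the image has sum zero. -/
theorem exists_laplacian_eq {W : Type*} [Fintype W] {H : SimpleGraph W} (hH : H.Connected)
    (b : W → ℝ) (hb : ∑ v, b v = 0) :
    ∃ g : W → ℝ, ∀ v, ∑ w with H.Adj v w, (g v - g w) = b v := by
  have := hH.nonempty
  let T : (W → ℝ) →ₗ[ℝ] (W → ℝ) :=
    { toFun := fun g v => (H.lapMatrix ℝ).mulVec g v + ∑ w, g w
      map_add' := fun f g => by
        ext v; simp only [Matrix.mulVec_add, Pi.add_apply, Finset.sum_add_distrib]; ring
      map_smul' := fun a g => by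
        ext v
        simp only [Matrix.mulVec_smul, Pi.smul_apply, smul_eq_mul, RingHom.id_apply,
          ← Finset.mul_sum]
        ring }
  have hT : ∀ g v, T g v = (H.lapMatrix ℝ).mulVec g v + ∑ w, g w := fun _ _ => rfl
  have hlap : ∀ g : W → ℝ, ∑ v, (H.lapMatrix ℝ).mulVec g v = 0 := fun g => by
    have h1 : ∑ v, (H.lapMatrix ℝ).mulVec g v
        = (fun _ => (1 : ℝ)) ⬝ᵥ (H.lapMatrix ℝ).mulVec g := by simp [dotProduct]
    rw [h1, Matrix.dotProduct_mulVec, ← Matrix.mulVec_transpose,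
      (SimpleGraph.isSymm_lapMatrix ℝ H).eq,
      H.lapMatrix_mulVec_const_eq_zero, zero_dotProduct]
  have hsum : ∀ g, ∑ v, T g v = 0 → ∑ w, g w = 0 := fun g hg => by
    simp only [hT, Finset.sum_add_distrib, hlap, zero_add, Finset.sum_const, Finset.card_univ,
      nsmul_eq_mul] at hg
    exact (mul_eq_zero.1 hg).resolve_left (by exact_mod_cast Fintype.card_ne_zero)
  have hinj : Function.Injective T := by
    rw [injective_iff_map_eq_zero]
    intro g hg
    have h0 : ∑ w, g w = 0 := hsum g (by simp [hg])
    have h1 : (H.lapMatrix ℝ).mulVec g = 0 := by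
      ext v
      have := congrFun hg v
      rwa [hT, h0, add_zero] at this
    rw [H.lapMatrix_mulVec_eq_zero_iff_forall_reachable] at h1
    ext v
    rw [Finset.sum_congr rfl fun w _ => h1 w v (hH.preconnected w v), Finset.sum_const,
      Finset.card_univ, nsmul_eq_mul] at h0
    exact (mul_eq_zero.1 h0).resolve_left (by exact_mod_cast Fintype.card_ne_zero)
  obtain ⟨g, hg⟩ := LinearMap.injective_iff_surjective.1 hinj b
  refine ⟨g, fun v => ?_⟩
  have h2 := congrFun hg v
  rw [hT, hsum g (by rw [hg, hb]), add_zero, SimpleGraph.lapMatrix_mulVec_apply] at h2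
  rw [← h2, Finset.sum_sub_distrib, Finset.sum_const, nsmul_eq_mul, H.neighborFinset_eq_filter]
  simp [← SimpleGraph.card_neighborFinset_eq_degree, H.neighborFinset_eq_filter]

variable {V : Type*} {G : SimpleGraph V}

open scoped Classical in
theorem exists_subgraph_laplacian_eq [Fintype V] {C : G.Subgraph} (hC : C.Connected)
    (b : V → ℝ) (hb : ∑ v with v ∈ C.verts, b v = 0) :
    ∃ g : V → ℝ, ∀ v ∈ C.verts, ∑ w with C.Adj v w, (g v - g w) = b v := by
  obtain ⟨g, hg⟩ := exists_laplacian_eq hC.coe (fun v => b v) (by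
    rw [← hb]
    exact (Finset.sum_subtype _ (by simp) b).symm)
  refine ⟨fun v => if h : v ∈ C.verts then g ⟨v, h⟩ else 0, fun v hv => ?_⟩
  rw [← hg ⟨v, hv⟩]
  symm
  refine Finset.sum_bij (fun w _ => (w : V)) ?_ ?_ ?_ ?_
  · simp
  · simp
  · intro w hw
    rw [Finset.mem_filter_univ] at hw
    exact ⟨⟨w, hw.snd_mem⟩, by simpa using hw, rfl⟩
  · intro w _
    simp [hv]

theorem IsPublicCluster.connected {pub : Set V} {C : G.Subgraph} (hC : IsPublicCluster G pub C) :
    C.Connected := hC.prop.1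

theorem IsPublicCluster.verts_subset {pub : Set V} {C : G.Subgraph}
    (hC : IsPublicCluster G pub C) : C.verts ⊆ pub := hC.prop.2

/-- By maximality, the edges of `G` from a node of a public-cluster to a public node belong to the
cluster. -/
theorem IsPublicCluster.adj_iff {pub : Set V} {C : G.Subgraph} (hC : IsPublicCluster G pub C)
    {v w : V} (hv : v ∈ C.verts) : C.Adj v w ↔ G.Adj v w ∧ w ∈ pub := by
  refine ⟨fun h => ⟨h.adj_sub, hC.verts_subset h.snd_mem⟩, fun ⟨h, hw⟩ => ?_⟩
  have hle : C ⊔ G.subgraphOfAdj h ≤ C := by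
    refine hC.le_of_ge ⟨?_, ?_⟩ le_sup_left
    · exact SimpleGraph.Subgraph.connected_sup hC.connected.preconnected
        (SimpleGraph.Subgraph.subgraphOfAdj_connected h).preconnected ⟨v, hv, by simp⟩
    · rw [SimpleGraph.Subgraph.verts_sup]
      refine Set.union_subset hC.verts_subset ?_
      rintro x (rfl | rfl)
      exacts [hC.verts_subset hv, hw]
  exact hle.2 (Or.inr (by simp))

open scoped Classical in
theorem publicDegree_eq_card [Fintype V] (C : G.Subgraph) (v : V) :
    publicDegree C v = (Finset.univ.filter (C.Adj v)).card := by
  rw [publicDegree, ← Set.ncard_coe_finset]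
  congr 1
  ext w
  simpa using fun h => C.edge_vert h.symm

theorem publicDegree_pos [Fintype V] {C : G.Subgraph} (hC : C.Connected)
    (hC2 : C.verts.Nontrivial) {v : V} (hv : v ∈ C.verts) : 0 < publicDegree C v := by
  classical
  have := hC2.coe_sort
  obtain ⟨w, hw⟩ := hC.preconnected.exists_adj_of_nontrivial ⟨v, hv⟩
  rw [publicDegree_eq_card]
  exact Finset.card_pos.2 ⟨w, by simpa using hw⟩

theorem publicDegreeSum_pos [Fintype V] {C : G.Subgraph} (hC : C.Connected)
    (hC2 : C.verts.Nontrivial) : 0 < publicDegreeSum C := by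
  obtain ⟨v, hv⟩ := hC2.nonempty
  exact Finset.sum_pos (fun w hw => publicDegree_pos hC hC2 (by simpa using hw))
    ⟨v, by simpa using hv⟩

open scoped Classical in
/-- The Poisson equation of the walk on a connected subgraph: the function `a` minus its mean with
weights `d*` is, up to a difference of a function `g` along the edges, centred at every node. -/
theorem exists_poisson_solution [Fintype V] {C : G.Subgraph} (hC : C.Connected)
    (hC2 : C.verts.Nontrivial) (a : V → ℝ) :
    ∃ g : V → ℝ, ∀ v ∈ C.verts, ∑ w with C.Adj v w,
      (a w - (∑ x with x ∈ C.verts, publicDegree C x * a x) / publicDegreeSum C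
        + (g w - g v)) = 0 := by
  set c : ℝ := (∑ x with x ∈ C.verts, publicDegree C x * a x) / publicDegreeSum C with hc
  have hD : (publicDegreeSum C : ℝ) ≠ 0 := by exact_mod_cast (publicDegreeSum_pos hC hC2).ne'
  obtain ⟨g, hg⟩ := exists_subgraph_laplacian_eq hC
      (fun v => ∑ w with C.Adj v w, (a w - c)) (by
    have h1 : ∀ v ∈ Finset.univ.filter (· ∈ C.verts), ∑ w with C.Adj v w, (a w - c)
        = ∑ w with w ∈ C.verts, if C.Adj v w then a w - c else 0 := fun v _ => by
      rw [← Finset.sum_filter, Finset.filter_filter]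
      refine Finset.sum_congr (Finset.filter_congr fun w _ => ?_) fun _ _ => rfl
      exact ⟨fun h => ⟨C.edge_vert h.symm, h⟩, fun h => h.2⟩
    have h2 : ∀ w ∈ Finset.univ.filter (· ∈ C.verts),
        (∑ v with v ∈ C.verts, if C.Adj v w then a w - c else 0)
          = publicDegree C w * a w - c * publicDegree C w := fun w _ => by
      rw [← Finset.sum_filter, Finset.filter_filter, Finset.sum_const, nsmul_eq_mul,
        publicDegree_eq_card,
        Finset.filter_congr (q := C.Adj w) fun v _ =>
          ⟨fun h => h.2.symm, fun h => ⟨C.edge_vert h.symm, h.symm⟩⟩]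
      ring
    rw [Finset.sum_congr rfl h1, Finset.sum_comm, Finset.sum_congr rfl h2,
      Finset.sum_sub_distrib, ← Finset.mul_sum, ← Nat.cast_sum]
    change _ - c * (publicDegreeSum C : ℝ) = 0
    rw [hc, div_mul_cancel₀ _ hD, sub_self])
  refine ⟨g, fun v hv => ?_⟩
  rw [Finset.sum_add_distrib, ← hg v hv, ← Finset.sum_add_distrib]
  exact Finset.sum_eq_zero fun w _ => by ring

end PublicWalk

/-! ### A law of large numbers along the walk -/

namespace PublicWalk

variable {V : Type*} {pub : Set V}

theorem position_congr (pub : Set V) (v : V) {h h' : ℕ → V} {t : ℕ} (hh : ∀ i < t, h i = h' i) :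
    position pub v h t = position pub v h' t := by
  induction t with
  | zero => rfl
  | succ t ih =>
    rw [position, position, hh t t.lt_succ_self, ih fun i hi => hh i (hi.trans t.lt_succ_self)]

/-- The sum of `φ` over the first `t` selections of the walk, `φ` being evaluated at the node where
the walk stands and the node that it selects. -/
noncomputable def selectionSum (pub : Set V) (φ : V → V → ℝ) (v : V) (h : ℕ → V) (t : ℕ) : ℝ :=
  ∑ s ∈ Finset.range t, φ (position pub v h s) (h s)

theorem selectionSum_succ (φ : V → V → ℝ) (v : V) (h : ℕ → V) (t : ℕ) :
    selectionSum pub φ v h (t + 1)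
      = selectionSum pub φ v h t + φ (position pub v h t) (h t) :=
  Finset.sum_range_succ _ _

theorem selectionSum_congr (φ : V → V → ℝ) (v : V) {h h' : ℕ → V} {t : ℕ}
    (hh : ∀ i < t, h i = h' i) : selectionSum pub φ v h t = selectionSum pub φ v h' t := by
  refine Finset.sum_congr rfl fun s hs => ?_
  rw [Finset.mem_range] at hs
  rw [position_congr pub v fun i hi => hh i (hi.trans hs), hh s hs]

theorem abs_selectionSum_le {φ : V → V → ℝ} {K : ℝ} (hK : ∀ v y, |φ v y| ≤ K) (v : V)
    (h : ℕ → V) (t : ℕ) : |selectionSum pub φ v h t| ≤ t * K :=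
  (Finset.abs_sum_le_sum_abs _ _).trans <|
    (Finset.sum_le_sum fun _ _ => hK _ _).trans (by simp)

/-- The function on `ℕ` that extends the finite history `h`, by the value `v`. -/
def extendHistory (v : V) {t : ℕ} (h : Fin t → V) (i : ℕ) : V :=
  if hi : i < t then h ⟨i, hi⟩ else v

theorem extendHistory_eq (v : V) {t : ℕ} (h : ℕ → V) {i : ℕ} (hi : i < t) :
    extendHistory v (fun j : Fin t => h j) i = h i := by simp [extendHistory, hi]

variable [Fintype V] [MeasurableSpace V]
  {G : SimpleGraph V} [DecidableRel G.Adj] {C : G.Subgraph}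
  {Ω : Type*} [MeasurableSpace Ω] {μ : Measure Ω} {seed : Ω → V} {u : ℕ → Ω → V}

theorem IsWalk.ae_adj (hw : IsWalk G pub C μ seed u) :
    ∀ᵐ ω ∂μ, ∀ t, G.Adj (position pub (seed ω) (fun i => u i ω) t) (u t ω) := by
  rw [ae_all_iff]
  intro t
  have key : ∀ᵐ ω ∂μ, ∀ (v : V) (h : Fin t → V) (y : V),
      ¬ G.Adj (position pub v (extendHistory v h) t) y →
        ¬ ((seed ω = v ∧ ∀ i < t, u i ω = extendHistory v h i) ∧ u t ω = y) := by
    simp only [ae_all_iff]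
    intro v h y hy
    have := hw.selection_law t v (extendHistory v h) y
    rw [if_neg hy, mul_zero] at this
    rw [ae_iff]
    simpa only [not_not] using this
  filter_upwards [key] with ω hω
  by_contra hc
  have hh : ∀ i < t, u i ω = extendHistory (seed ω) (fun j : Fin t => u j ω) i :=
    fun i hi => (extendHistory_eq (seed ω) (fun i => u i ω) hi).symm
  refine hω (seed ω) (fun j => u j ω) (u t ω) ?_ ⟨⟨rfl, hh⟩, rfl⟩
  rwa [← position_congr pub (seed ω) hh]

variable [DiscreteMeasurableSpace V]

theorem IsWalk.measurable_position (hw : IsWalk G pub C μ seed u) (t : ℕ) :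
    Measurable fun ω => position pub (seed ω) (fun i => u i ω) t := by
  induction t with
  | zero => exact hw.measurable_seed
  | succ t ih =>
    exact Measurable.ite (hw.measurable_selection t (MeasurableSet.of_discrete (s := pub)))
      (hw.measurable_selection t) ih

theorem IsWalk.measurable_step (hw : IsWalk G pub C μ seed u) (φ : V → V → ℝ) (t : ℕ) :
    Measurable fun ω => φ (position pub (seed ω) (fun i => u i ω) t) (u t ω) :=
  (Measurable.of_discrete (f := fun p : V × V => φ p.1 p.2)).comp
    ((hw.measurable_position t).prodMk (hw.measurable_selection t))

theorem IsWalk.measurable_selectionSum (hw : IsWalk G pub C μ seed u) (φ : V → V → ℝ) (t : ℕ) :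
    Measurable fun ω => selectionSum pub φ (seed ω) (fun i => u i ω) t :=
  Finset.measurable_sum _ fun s _ => hw.measurable_step φ s

/-- A step that is centred over the neighbours of the current node is orthogonal to every function
of the past. -/
theorem IsWalk.integral_past_mul_step_eq_zero [IsProbabilityMeasure μ]
    (hw : IsWalk G pub C μ seed u) (t : ℕ) (Φ : V → (ℕ → V) → ℝ)
    (hΦ : ∀ v h h', (∀ i < t, h i = h' i) → Φ v h = Φ v h')
    {φ : V → V → ℝ} (hφ : ∀ v, ∑ y ∈ G.neighborFinset v, φ v y = 0) :
    ∫ ω, Φ (seed ω) (fun i => u i ω) * φ (position pub (seed ω) (fun i => u i ω) t) (u t ω) ∂μ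
      = 0 := by
  -- The integrand is a function of a random variable with values in a finite type.
  let Z : Ω → V × (Fin t → V) × V := fun ω => (seed ω, fun i => u i ω, u t ω)
  have hZ : Measurable Z := hw.measurable_seed.prodMk
    ((measurable_pi_lambda (fun ω (i : Fin t) => u i ω) fun i => hw.measurable_selection i).prodMk
      (hw.measurable_selection t))
  let F : V × (Fin t → V) × V → ℝ := fun z =>
    Φ z.1 (extendHistory z.1 z.2.1) * φ (position pub z.1 (extendHistory z.1 z.2.1) t) z.2.2
  have hF : ∀ ω, Φ (seed ω) (fun i => u i ω) *
      φ (position pub (seed ω) (fun i => u i ω) t) (u t ω) = F (Z ω) := fun ω => by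
    have hh : ∀ i < t, u i ω = extendHistory (seed ω) (fun j : Fin t => u j ω) i :=
      fun i hi => (extendHistory_eq (seed ω) (fun i => u i ω) hi).symm
    simp only [F, Z]
    rw [hΦ _ _ _ hh, position_congr pub (seed ω) hh]
  have := Measure.isProbabilityMeasure_map (μ := μ) hZ.aemeasurable
  simp_rw [hF]
  rw [← integral_map hZ.aemeasurable Measurable.of_discrete.aestronglyMeasurable,
    integral_fintype .of_finite, Fintype.sum_prod_type]
  refine Finset.sum_eq_zero fun v _ => ?_
  rw [Fintype.sum_prod_type]
  refine Finset.sum_eq_zero fun h _ => ?_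
  have hlaw : ∀ y, (μ.map Z).real {(v, h, y)} =
      μ.real {ω | seed ω = v ∧ ∀ i < t, u i ω = extendHistory v h i} *
        (if G.Adj (position pub v (extendHistory v h) t) y then
          (G.degree (position pub v (extendHistory v h) t) : ℝ)⁻¹ else 0) := fun y => by
    have hset : Z ⁻¹' {(v, h, y)} =
        {ω | (seed ω = v ∧ ∀ i < t, u i ω = extendHistory v h i) ∧ u t ω = y} := by
      ext ω
      simp only [Z, Set.mem_preimage, Set.mem_singleton_iff, Prod.mk.injEq, funext_iff,
        Set.mem_ofPred_eq, and_assoc, Fin.forall_iff]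
      refine and_congr_right fun _ => and_congr_left fun _ => forall₂_congr fun i hi => ?_
      simp [extendHistory, hi]
    rw [measureReal_def, Measure.map_apply hZ (.singleton _), hset, hw.selection_law,
      ENNReal.toReal_mul, measureReal_def]
    split_ifs <;> simp
  simp only [hlaw, F, smul_eq_mul]
  set p := position pub v (extendHistory v h) t
  have hy : ∀ y ∈ Finset.univ (α := V),
      μ.real {ω | seed ω = v ∧ ∀ i < t, u i ω = extendHistory v h i} *
        (if G.Adj p y then (G.degree p : ℝ)⁻¹ else 0) * (Φ v (extendHistory v h) * φ p y) =
      (μ.real {ω | seed ω = v ∧ ∀ i < t, u i ω = extendHistory v h i} * (G.degree p : ℝ)⁻¹ *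
        Φ v (extendHistory v h)) * (if G.Adj p y then φ p y else 0) := fun y _ => by
    split_ifs <;> ring
  rw [Finset.sum_congr rfl hy, ← Finset.mul_sum, ← Finset.sum_filter,
    ← G.neighborFinset_eq_filter, hφ, mul_zero]

theorem IsWalk.integral_selectionSum_sq_le [IsProbabilityMeasure μ]
    (hw : IsWalk G pub C μ seed u) {φ : V → V → ℝ}
    (hφ : ∀ v, ∑ y ∈ G.neighborFinset v, φ v y = 0) {K : ℝ} (hK : ∀ v y, |φ v y| ≤ K) (t : ℕ) :
    ∫ ω, selectionSum pub φ (seed ω) (fun i => u i ω) t ^ 2 ∂μ ≤ t * K ^ 2 := by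
  induction t with
  | zero => simp [selectionSum]
  | succ t ih =>
    have hS := hw.measurable_selectionSum φ t
    have hX := hw.measurable_step φ t
    have i1 : Integrable (fun ω => selectionSum pub φ (seed ω) (fun i => u i ω) t ^ 2) μ :=
      .of_bound (hS.pow_const 2).aestronglyMeasurable ((t * K) ^ 2) (.of_forall fun ω => by
        rw [Real.norm_eq_abs, abs_pow]
        gcongr
        exact abs_selectionSum_le hK _ _ _)
    have i2 : Integrable (fun ω => 2 * (selectionSum pub φ (seed ω) (fun i => u i ω) t *
        φ (position pub (seed ω) (fun i => u i ω) t) (u t ω))) μ :=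
      (Integrable.of_bound (hS.mul hX).aestronglyMeasurable (t * K * K) (.of_forall fun ω => by
        rw [Real.norm_eq_abs, Pi.mul_apply, abs_mul]
        have hS' := abs_selectionSum_le (pub := pub) hK (seed ω) (fun i => u i ω) t
        exact mul_le_mul hS' (hK _ _) (abs_nonneg _) ((abs_nonneg _).trans hS'))).const_mul 2
    have i3 : Integrable
        (fun ω => φ (position pub (seed ω) (fun i => u i ω) t) (u t ω) ^ 2) μ :=
      .of_bound (hX.pow_const 2).aestronglyMeasurable (K ^ 2) (.of_forall fun ω => by
        rw [Real.norm_eq_abs, abs_pow]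
        gcongr
        exact hK _ _)
    simp_rw [selectionSum_succ, add_sq, mul_assoc]
    rw [integral_add (by exact i1.add i2) i3, integral_add i1 i2, integral_const_mul,
      hw.integral_past_mul_step_eq_zero t (fun v h => selectionSum pub φ v h t)
        (fun v h h' hh => selectionSum_congr φ v hh) hφ]
    have h3 : ∫ ω, φ (position pub (seed ω) (fun i => u i ω) t) (u t ω) ^ 2 ∂μ ≤ K ^ 2 := by
      refine (integral_mono i3 (integrable_const (K ^ 2)) fun ω => ?_).trans (by simp)
      exact sq_le_sq.2 ((hK _ _).trans (le_abs_self K))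
    push_cast
    linarith

/-- The selection sums of a step function that is centred over the neighbours of the current node
are `o(t)` almost surely. -/
theorem IsWalk.ae_tendsto_selectionSum_div [IsProbabilityMeasure μ]
    (hw : IsWalk G pub C μ seed u) {φ : V → V → ℝ}
    (hφ : ∀ v, ∑ y ∈ G.neighborFinset v, φ v y = 0) :
    ∀ᵐ ω ∂μ, Tendsto (fun t : ℕ => selectionSum pub φ (seed ω) (fun i => u i ω) t / t)
      atTop (𝓝 0) := by
  obtain ⟨K, hK⟩ : ∃ K, ∀ v y, |φ v y| ≤ K := by
    obtain ⟨K, hK⟩ := (Set.finite_range fun p : V × V => |φ p.1 p.2|).bddAbove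
    exact ⟨K, fun v y => hK ⟨(v, y), rfl⟩⟩
  set S : ℕ → Ω → ℝ := fun t ω => selectionSum pub φ (seed ω) (fun i => u i ω) t with hS
  -- Along the squares, the second moments of the averages are summable.
  let A : ℕ → Ω → ℝ := fun n ω => S ((n + 1) ^ 2) ω / ((n + 1) ^ 2 : ℕ)
  have hAm : ∀ n, Measurable (A n) := fun n => (hw.measurable_selectionSum φ _).div_const _
  have hA : ∀ n, ∫⁻ ω, ENNReal.ofReal (A n ω ^ 2) ∂μ
      ≤ ENNReal.ofReal (K ^ 2 * (1 / ((n + 1 : ℕ) : ℝ) ^ 2)) := fun n => by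
    rw [← ofReal_integral_eq_lintegral_ofReal _ (.of_forall fun ω => sq_nonneg _)]
    · refine ENNReal.ofReal_le_ofReal ?_
      have h1 := hw.integral_selectionSum_sq_le hφ hK ((n + 1) ^ 2)
      simp only [A, div_pow]
      rw [integral_div, div_le_iff₀ (by positivity)]
      refine h1.trans (le_of_eq ?_)
      push_cast
      field_simp
    · refine .of_bound ((hAm n).pow_const 2).aestronglyMeasurable (K ^ 2) (.of_forall fun ω => ?_)
      rw [Real.norm_eq_abs, abs_pow]
      gcongr
      simp only [A]
      rw [abs_div, Nat.abs_cast, div_le_iff₀ (by positivity), mul_comm]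
      exact abs_selectionSum_le hK _ _ _
  have hsum : ∫⁻ ω, ∑' n, ENNReal.ofReal (A n ω ^ 2) ∂μ ≠ ⊤ := by
    rw [lintegral_tsum fun n => ((hAm n).pow_const 2).ennreal_ofReal.aemeasurable]
    refine ne_top_of_le_ne_top ?_ (ENNReal.tsum_le_tsum hA)
    refine Summable.tsum_ofReal_ne_top (Summable.mul_left _ ?_)
    exact (summable_nat_add_iff 1).2 (Real.summable_one_div_nat_pow.2 one_lt_two)
  have hae := ae_lt_top (Measurable.tsum fun n =>
    ((hAm n).pow_const 2).ennreal_ofReal) hsum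
  filter_upwards [hae] with ω hω
  have h0 : Tendsto (fun n => A n ω) atTop (𝓝 0) := by
    have h1 := ENNReal.tendsto_atTop_zero_of_tsum_ne_top hω.ne
    have h2 := (ENNReal.tendsto_toReal ENNReal.zero_ne_top).comp h1
    simp only [Function.comp_def, ENNReal.toReal_ofReal (sq_nonneg _), ENNReal.toReal_zero] at h2
    have h3 := h2.sqrt
    simp only [Real.sqrt_sq_eq_abs, Real.sqrt_zero] at h3
    exact (tendsto_zero_iff_abs_tendsto_zero _).2 h3
  -- The sequence `S t + K t` is monotone, so its averages converge along all `t` as well.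
  have hmono : Monotone fun t : ℕ => S t ω + K * t := by
    refine monotone_nat_of_le_succ fun t => ?_
    simp only [hS, selectionSum_succ]
    have := (abs_le.1 (hK (position pub (seed ω) (fun i => u i ω) t) (u t ω))).1
    push_cast
    linarith
  have hlim := tendsto_div_of_monotone_of_exists_subseq_tendsto_div _ K hmono fun a ha => by
    refine ⟨fun n => (n + 1) ^ 2, ?_, ?_, ?_⟩
    · have h1 : Tendsto (fun n : ℕ => (1 + 1 / ((n : ℝ) + 1)) ^ 2) atTop (𝓝 ((1 + 0) ^ 2)) :=
        (tendsto_one_div_add_atTop_nhds_zero_nat.const_add 1).pow 2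
      filter_upwards [h1.eventually_le_const (by simpa using ha)] with n hn
      have : (((n + 1 + 1) ^ 2 : ℕ) : ℝ) = (1 + 1 / ((n : ℝ) + 1)) ^ 2 * ((n + 1) ^ 2 : ℕ) := by
        push_cast
        field_simp
      rw [this]
      gcongr
    · exact (tendsto_pow_atTop two_ne_zero).comp (tendsto_add_atTop_nat 1)
    · have h1 := h0.add_const K
      rw [zero_add] at h1
      refine h1.congr fun n => ?_
      simp only [A]
      field_simp
  have h1 := hlim.sub_const K
  rw [sub_self] at h1
  refine h1.congr' ?_
  filter_upwards [eventually_gt_atTop 0] with t ht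
  field_simp
  ring

end PublicWalk

/-! ### From selections to samples -/

namespace PublicWalk

variable {V : Type*} {G : SimpleGraph V} {pub : Set V} {C : G.Subgraph}

theorem IsPublicCluster.position_mem (hC : IsPublicCluster G pub C) {v : V} (hv : v ∈ C.verts)
    {h : ℕ → V} (hadj : ∀ t, G.Adj (position pub v h t) (h t)) (t : ℕ) :
    position pub v h t ∈ C.verts := by
  induction t with
  | zero => exact hv
  | succ t ih =>
    rw [position]
    split_ifs with hp
    · exact ((hC.adj_iff ih).2 ⟨hadj t, hp⟩).snd_mem
    · exact ih

open scoped Classical in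
/-- The step function of the Poisson equation: the deviation of `a` from `c` at a selected public
node, corrected by the increment of `g`. It vanishes if the selected node is private, and off the
cluster, where the Poisson equation says nothing. -/
noncomputable def poissonStep (pub : Set V) (C : G.Subgraph) (a g : V → ℝ) (c : ℝ) (v y : V) : ℝ :=
  if v ∈ C.verts ∧ y ∈ pub then a y - c + (g y - g v) else 0

open scoped Classical in
/-- The indicator of the selection of a public node, minus its conditional probability `d* / d`;
zero off the cluster. -/
noncomputable def publicStep [Fintype V] [DecidableRel G.Adj] (pub : Set V) (C : G.Subgraph)
    (v y : V) : ℝ :=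
  if v ∈ C.verts then (if y ∈ pub then 1 else 0) - (publicDegree C v : ℝ) / G.degree v else 0

open scoped Classical in
theorem IsPublicCluster.sum_neighborFinset_ite [Fintype V] [DecidableRel G.Adj]
    (hC : IsPublicCluster G pub C) {v : V} (hv : v ∈ C.verts) (F : V → ℝ) :
    ∑ y ∈ G.neighborFinset v, (if y ∈ pub then F y else 0) = ∑ y with C.Adj v y, F y := by
  rw [← Finset.sum_filter]
  refine Finset.sum_congr ?_ fun _ _ => rfl
  ext y
  simp [hC.adj_iff hv]

open scoped Classical in
theorem IsPublicCluster.sum_poissonStep [Fintype V] [DecidableRel G.Adj]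
    (hC : IsPublicCluster G pub C) {a g : V → ℝ} {c : ℝ}
    (hg : ∀ v ∈ C.verts, ∑ w with C.Adj v w, (a w - c + (g w - g v)) = 0) (v : V) :
    ∑ y ∈ G.neighborFinset v, poissonStep pub C a g c v y = 0 := by
  by_cases hv : v ∈ C.verts
  · simp only [poissonStep, hv, true_and]
    rw [hC.sum_neighborFinset_ite hv, hg v hv]
  · simp [poissonStep, hv]

theorem degree_pos_of_mem_verts [Fintype V] [DecidableRel G.Adj] (hC : C.Connected)
    (hC2 : C.verts.Nontrivial) {v : V} (hv : v ∈ C.verts) : 0 < G.degree v := by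
  have := hC2.coe_sort
  obtain ⟨w, hw⟩ := hC.preconnected.exists_adj_of_nontrivial ⟨v, hv⟩
  exact (G.degree_pos_iff_exists_adj v).2 ⟨w, hw.adj_sub⟩

theorem IsPublicCluster.sum_publicStep [Fintype V] [DecidableRel G.Adj]
    (hC : IsPublicCluster G pub C) (hC2 : C.verts.Nontrivial) (v : V) :
    ∑ y ∈ G.neighborFinset v, publicStep pub C v y = 0 := by
  classical
  by_cases hv : v ∈ C.verts
  · have hd : (G.degree v : ℝ) ≠ 0 := by
      exact_mod_cast (degree_pos_of_mem_verts hC.connected hC2 hv).ne'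
    simp only [publicStep, hv, if_true, Finset.sum_sub_distrib]
    rw [hC.sum_neighborFinset_ite hv, Finset.sum_const, Finset.sum_const,
      G.card_neighborFinset_eq_degree, ← publicDegree_eq_card, nsmul_eq_mul, nsmul_eq_mul, mul_one,
      mul_div_cancel₀ _ hd, sub_self]
  · simp [publicStep, hv]

open scoped Classical in
/-- Along a path of the walk, the increments of `g` telescope. -/
theorem selectionSum_poissonStep {v : V} {h : ℕ → V}
    (hpos : ∀ t, position pub v h t ∈ C.verts) (a g : V → ℝ) (c : ℝ) (t : ℕ) :
    selectionSum pub (poissonStep pub C a g c) v h t =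
      ∑ k ∈ Finset.range (Nat.count (fun s => h s ∈ pub) t),
        (a (h (Nat.nth (fun s => h s ∈ pub) k)) - c) + (g (position pub v h t) - g v) := by
  induction t with
  | zero => simp [selectionSum, position]
  | succ t ih =>
    rw [selectionSum_succ, ih, poissonStep, position, Nat.count_succ]
    by_cases hp : h t ∈ pub
    · rw [if_pos ⟨hpos t, hp⟩, if_pos hp, if_pos hp, Finset.sum_range_succ,
        Nat.nth_count (p := fun s => h s ∈ pub) hp]
      ring
    · simp [hp]

open scoped Classical in
/-- At each node of the cluster a public node is selected with conditional probability at least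
`1 / |V|`, since `1 ≤ d*` and `d ≤ |V|`. -/
theorem selectionSum_publicStep_le [Fintype V] [DecidableRel G.Adj] (hC : C.Connected)
    (hC2 : C.verts.Nontrivial) {v : V} {h : ℕ → V}
    (hpos : ∀ t, position pub v h t ∈ C.verts) (t : ℕ) :
    selectionSum pub (publicStep pub C) v h t ≤
      Nat.count (fun s => h s ∈ pub) t - t * (1 / (Fintype.card V : ℝ)) := by
  induction t with
  | zero => simp [selectionSum]
  | succ t ih =>
    have h1 : 1 / (Fintype.card V : ℝ) ≤
        (publicDegree C (position pub v h t) : ℝ) / G.degree (position pub v h t) := by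
      have hd := degree_pos_of_mem_verts hC hC2 (hpos t)
      gcongr
      · exact_mod_cast publicDegree_pos hC hC2 (hpos t)
      · exact_mod_cast (G.degree_lt_card_verts _).le
    rw [selectionSum_succ, publicStep, if_pos (hpos t), Nat.count_succ]
    push_cast
    linarith

open scoped Classical in
/-- A set of natural numbers of positive lower density is infinite. -/
theorem infinite_of_eventually_le_count {p : ℕ → Prop} {δ : ℝ} (hδ : 0 < δ)
    (hp : ∀ᶠ t : ℕ in atTop, δ * t ≤ Nat.count p t) : {t | p t}.Infinite := by
  intro hfin
  have h1 : Tendsto (fun t : ℕ => δ * (t : ℝ)) atTop atTop :=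
    tendsto_natCast_atTop_atTop.const_mul_atTop hδ
  obtain ⟨t, ht, ht'⟩ := (hp.and (h1.eventually_gt_atTop (hfin.toFinset.card : ℝ))).exists
  have h2 : Nat.count p t ≤ hfin.toFinset.card := by
    rw [Nat.count_eq_card_filter_range]
    exact Finset.card_le_card fun s hs => by simpa using (Finset.mem_filter.1 hs).2
  have h3 : (Nat.count p t : ℝ) ≤ hfin.toFinset.card := by exact_mod_cast h2
  linarith

open scoped Classical in
/-- Along a path on which the two centred step functions average to zero, infinitely many public
nodes are selected, and the averages of `a` over them converge to `c`. -/
theorem tendsto_average_of_tendsto_selectionSum [Fintype V] [DecidableRel G.Adj]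
    (hC : C.Connected) (hC2 : C.verts.Nontrivial) {v : V} {h : ℕ → V}
    (hpos : ∀ t, position pub v h t ∈ C.verts) (a g : V → ℝ) (c : ℝ)
    (h1 : Tendsto (fun t : ℕ => selectionSum pub (poissonStep pub C a g c) v h t / t)
      atTop (𝓝 0))
    (h2 : Tendsto (fun t : ℕ => selectionSum pub (publicStep pub C) v h t / t)
      atTop (𝓝 0)) :
    {t | h t ∈ pub}.Infinite ∧
      Tendsto (fun r : ℕ => (∑ k ∈ Finset.range r,
        (a (h (Nat.nth (fun s => h s ∈ pub) k)) - c)) / r) atTop (𝓝 0) := by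
  have : Nonempty V := ⟨v⟩
  set p : ℕ → Prop := fun s => h s ∈ pub with hp
  set δ : ℝ := 1 / (Fintype.card V : ℝ) with hδ
  have hδ0 : 0 < δ := by positivity
  have hcount : ∀ᶠ t : ℕ in atTop, δ / 2 * t ≤ Nat.count p t := by
    filter_upwards [h2.eventually_const_le (show -(δ / 2) < 0 by linarith), eventually_gt_atTop 0]
      with t ht ht0
    have ht0' : (0 : ℝ) < t := by exact_mod_cast ht0
    rw [le_div_iff₀ ht0'] at ht
    have := selectionSum_publicStep_le hC hC2 hpos t
    linarith
  have hinf : {t | p t}.Infinite := infinite_of_eventually_le_count (by positivity) hcount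
  refine ⟨hinf, ?_⟩
  have hτ : Tendsto (Nat.nth p) atTop atTop := (Nat.nth_strictMono hinf).tendsto_atTop
  obtain ⟨B, hB⟩ := (Set.finite_range fun x : V => |g x|).bddAbove
  have hB' : ∀ x, |g x| ≤ B := fun x => hB ⟨x, rfl⟩
  -- At the time of the `r`-th public selection the increment of `g` is at most `2 B`, and that
  -- time is at most `(2 / δ) r`.
  have hlim : Tendsto (fun r : ℕ =>
      |selectionSum pub (poissonStep pub C a g c) v h (Nat.nth p r) / (Nat.nth p r : ℕ)| * (2 / δ)
        + 2 * B / r) atTop (𝓝 (|0| * (2 / δ) + 0)) :=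
    ((h1.comp hτ).abs.mul_const _).add (tendsto_const_div_atTop_nhds_zero_nat _)
  rw [abs_zero, zero_mul, add_zero] at hlim
  refine squeeze_zero_norm' ?_ hlim
  filter_upwards [hτ.eventually hcount, hτ.eventually_gt_atTop 0, eventually_gt_atTop 0]
    with r hr hτ0 hr0
  have hr0' : (0 : ℝ) < r := by exact_mod_cast hr0
  have hτ0' : (0 : ℝ) < (Nat.nth p r : ℕ) := by exact_mod_cast hτ0
  rw [Nat.count_nth_of_infinite hinf] at hr
  have hM := selectionSum_poissonStep hpos a g c (Nat.nth p r)
  rw [Nat.count_nth_of_infinite hinf] at hM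
  set M := selectionSum pub (poissonStep pub C a g c) v h (Nat.nth p r)
  set E := ∑ k ∈ Finset.range r, (a (h (Nat.nth p k)) - c)
  set T : ℝ := ((Nat.nth p r : ℕ) : ℝ)
  have hE : |E| ≤ |M| + 2 * B := by
    have e1 : E = M - (g (position pub v h (Nat.nth p r)) - g v) := by rw [hM]; ring
    have e2 := abs_sub M (g (position pub v h (Nat.nth p r)) - g v)
    have e3 := abs_sub (g (position pub v h (Nat.nth p r))) (g v)
    rw [e1]
    linarith [hB' (position pub v h (Nat.nth p r)), hB' v]
  have hMr : |M| / r ≤ |M| / T * (2 / δ) := by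
    rw [div_mul_div_comm, div_le_div_iff₀ hr0' (by positivity)]
    nlinarith [abs_nonneg M]
  rw [Real.norm_eq_abs, abs_div, abs_div, Nat.abs_cast, Nat.abs_cast]
  calc |E| / r ≤ (|M| + 2 * B) / r := by gcongr
    _ = |M| / r + 2 * B / r := add_div _ _ _
    _ ≤ _ := by gcongr

theorem tendsto_avgDegreeEstimate [Fintype V] [DecidableRel G.Adj] {v : V} {h : ℕ → V} {c : ℝ}
    (hc : c ≠ 0)
    (hlim : Tendsto (fun r : ℕ => (∑ k ∈ Finset.range r,
      (1 / (G.degree (h (Nat.nth (fun s => h s ∈ pub) k)) : ℝ) - c)) / r) atTop (𝓝 0)) :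
    Tendsto (fun r : ℕ => avgDegreeEstimate G (sample pub v h) r) atTop (𝓝 c⁻¹) := by
  have h1 := ((hlim.mul (tendsto_natCast_div_add_atTop (1 : ℝ))).add
    ((tendsto_const_div_atTop_nhds_zero_nat (1 / (G.degree v : ℝ) - c)).comp
      (tendsto_add_atTop_nat 1))).add_const c
  rw [zero_mul, zero_add, zero_add] at h1
  -- The seed is sampled before the first selection, which shifts the index by one.
  refine (tendsto_add_atTop_iff_nat 1).1 ((h1.inv₀ hc).congr fun r => ?_)
  have hs : ∑ k ∈ Finset.range (r + 1), 1 / (G.degree (sample pub v h k) : ℝ) =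
      ∑ k ∈ Finset.range r, 1 / (G.degree (h (Nat.nth (fun s => h s ∈ pub) k)) : ℝ) +
        1 / (G.degree v : ℝ) := Finset.sum_range_succ' _ _
  rw [avgDegreeEstimate, ← inv_div, hs]
  simp only [Function.comp_apply, Finset.sum_sub_distrib, Finset.sum_const,
    Finset.card_range, nsmul_eq_mul]
  rcases Nat.eq_zero_or_pos r with rfl | hr
  · simp
  · push_cast
    field_simp
    ring

open scoped Classical in
theorem limitAvgDegree_eq_inv [Fintype V] [DecidableRel G.Adj] (C : G.Subgraph) :
    limitAvgDegree G C = ((∑ x with x ∈ C.verts, publicDegree C x * (1 / (G.degree x : ℝ))) /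
      publicDegreeSum C)⁻¹ := by
  simp [limitAvgDegree, div_eq_mul_inv]

end PublicWalk

theorem mainTheorem6 {V : Type*} [Fintype V] [MeasurableSpace V] [DiscreteMeasurableSpace V]
    (G : SimpleGraph V) [DecidableRel G.Adj] (hG : G.Connected)
    (pub : Set V) (C : G.Subgraph) (hC : PublicWalk.IsLargestPublicCluster G pub C)
    (hC2 : C.verts.Nontrivial)
    {Ω : Type*} [MeasurableSpace Ω] (μ : Measure Ω) [IsProbabilityMeasure μ]
    (seed : Ω → V) (u : ℕ → Ω → V) (hwalk : PublicWalk.IsWalk G pub C μ seed u) :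
    ∀ᵐ ω ∂μ, {t | u t ω ∈ pub}.Infinite ∧
      Tendsto
        (fun r : ℕ => PublicWalk.avgDegreeEstimate G
          (PublicWalk.sample pub (seed ω) (fun t => u t ω)) r)
        atTop (𝓝 (PublicWalk.limitAvgDegree G C)) := by
  classical
  have hcl := hC.1
  have hcon := hcl.connected
  obtain ⟨g, hg⟩ := PublicWalk.exists_poisson_solution hcon hC2 fun x => 1 / (G.degree x : ℝ)
  rw [PublicWalk.limitAvgDegree_eq_inv]
  have hc : (∑ x with x ∈ C.verts, PublicWalk.publicDegree C x * (1 / (G.degree x : ℝ))) /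
      PublicWalk.publicDegreeSum C ≠ 0 := by
    have h1 : (0 : ℝ) < PublicWalk.publicDegreeSum C := by
      exact_mod_cast PublicWalk.publicDegreeSum_pos hcon hC2
    refine (div_pos (Finset.sum_pos (fun x hx => ?_) ?_) h1).ne'
    · rw [Finset.mem_filter_univ] at hx
      have h2 := PublicWalk.publicDegree_pos hcon hC2 hx
      have h3 := PublicWalk.degree_pos_of_mem_verts hcon hC2 hx
      positivity
    · obtain ⟨x, hx⟩ := hC2.nonempty
      exact ⟨x, by simpa using hx⟩
  filter_upwards [hwalk.seed_mem, hwalk.ae_adj,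
    hwalk.ae_tendsto_selectionSum_div (hcl.sum_poissonStep hg),
    hwalk.ae_tendsto_selectionSum_div (hcl.sum_publicStep hC2)] with ω hv hadj h1 h2
  obtain ⟨hinf, hlim⟩ := PublicWalk.tendsto_average_of_tendsto_selectionSum hcon hC2
    (hcl.position_mem hv hadj) _ g _ h1 h2
  exact ⟨hinf, PublicWalk.tendsto_avgDegreeEstimate hc hlim⟩
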